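/- **Lemma (Steep quantum hill-climber).** Let $\varphi(\mathbf x)=\sum_{i=1}^m w_iC_i(\mathbf x)$, $\mathbf x\in\{0,1\}^n$, be the objective function of a weighted MAX-$k$-SAT instance on $n$ variables, where every clause $C_i$ is a disjunction of at most $k$ literals and $w_i\in\mathbb R$. For $d\ge 0$ let $\mathcal N_d(\mathbf x)$ be the set of bit strings other than $\mathbf x$ that differ from $\mathbf x$ in at most $d$ positions. A *classical steep hill climber* starts at some $\mathbf x_0$ and in every iteration moves from the current string $\mathbf x$ to a maximiser of $\varphi$ over $\mathcal N_d(\mathbf x)$ (ties broken by an arbitrary rule) if that maximiser has a value strictly larger than $\varphi(\mathbf x)$, and stops otherwise; it also stops after a prescribed maximal number $T$ of iterations. For $\mathbf y\in\{0,1\}^n$ let $f_{\mathbf y}(\mathbf x)=1$ if $\varphi(\mathbf x)>\varphi(\mathbf y)$ and $f_{\mathbf y}(\mathbf x)=0$ otherwise, and let $\mathcal O_{f_{\mathbf y}}|\mathbf x\rangle|b\rangle=|\mathbf x\rangle|b\oplus f_{\mathbf y}(\mathbf x)\rangle$. Quantum algorithms here may run quantum circuits, measure, toss coins and continue adaptively;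 they have access to $\varphi$ only through queries to the oracles $\mathcal O_{f_{\mathbf y}}$, each of which is implemented with $c_q$ calls to $\varphi$. For every $d$ there are constants $C>0$ and $a\in\mathbb N$ such that for every $n$ there is a quantum subroutine **QMax** (depending only on $n$ and $d$; its input is the iteration number $t$ and the current string) such that the following holds for all $k$ and every MAX-$k$-SAT instance $\varphi$ on $n$ variables. At every $t$ and $\mathbf x$, QMax returns with probability at least $2/3$ a correct steep-ascent decision at $\mathbf x$, that is, a maximiser of $\varphi$ over $\mathcal N_d(\mathbf x)$ with value strictly larger than $\varphi(\mathbf x)$, or, if no neighbour has a strictly larger value, the answer "stop". Consider the *steep quantum hill-climber*, which performs its local search in each iteration by QMax. For all $T\in\mathbb N$ and all initial strings $\mathbf x_0$: 1. with probability at least $2/3$, the sequence of bit strings that it visits is exactly that of some classical steep hill climber started at $\mathbf x_0$ and limited to $T$ iterations; 2. if $N\le T$ denotes the (random) number of iterations it performs, then for every $c_q\in\mathbb N$ the expected number of calls to $\varphi$ is at most $$\mathbb E\Big[\sum_{t=1}^{N} C\,c_q\,n^{d/2}\,\log^{a}(nt+2)\Big],$$ i.e. $\sum_{t}\tilde{\mathcal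 O}(n^{d/2})$, where $\tilde{\mathcal O}$ hides factors polylogarithmic in $n$ and in the iteration number $t$. -/

import Mathlib

open scoped ENNReal

/-! ### MAX-k-SAT -/

/-- Bit strings of length `n`, i.e. assignments of truth values to `n` Boolean variables. -/
abbrev BitString (n : ℕ) : Type := Fin n → Bool

/-- A weighted MAX-`k`-SAT instance on `n` variables: finitely many clauses, each a disjunction of
at most `k` literals, with real weights. The literal `(i, b)` is satisfied by `x` iff `x i = b`,
so `(i, true)` is the `i`-th variable and `(i, false)` its negation. -/
structure MaxSatInstance (n k : ℕ) where
  numClauses : ℕ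
  clause : Fin numClauses → Finset (Fin n × Bool)
  clause_card_le : ∀ i, (clause i).card ≤ k
  weight : Fin numClauses → ℝ

/-- The assignment `x` satisfies the clause `c`. -/
def clauseSat {n : ℕ} (c : Finset (Fin n × Bool)) (x : BitString n) : Prop :=
  ∃ l ∈ c, x l.1 = l.2

open Classical in
/-- The objective function `φ(x) = ∑ i, w i * C i (x)`. -/
noncomputable def MaxSatInstance.objective {n k : ℕ} (I : MaxSatInstance n k)
    (x : BitString n) : ℝ :=
  ∑ i, I.weight i * (if clauseSat (I.clause i) x then 1 else 0)

open Classical in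
/-- The marking function `f_y(x)`, which is `1` iff `φ(x) > φ(y)`. -/
noncomputable def markFun {n : ℕ} (φ : BitString n → ℝ) (y x : BitString n) : Bool :=
  decide (φ y < φ x)

/-! ### Classical steep-ascent hill climbers -/

/-- The `d`-level neighbourhood of `x`: all other bit strings at Hamming distance at most `d`. -/
def neighbourhood {n : ℕ} (d : ℕ) (x : BitString n) : Set (BitString n) :=
  {y | y ≠ x ∧ hammingDist x y ≤ d}

/-- `o` is a correct steep-ascent decision at `x`: either a move to a neighbour that maximises `φ`
over the neighbourhood and has a strictly larger value than `x`, or the decision to stop (`none`)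
when no neighbour has a strictly larger value. -/
def IsSteepMove {n : ℕ} (φ : BitString n → ℝ) (d : ℕ) (x : BitString n) :
    Option (BitString n) → Prop
  | some y => y ∈ neighbourhood d x ∧ φ x < φ y ∧ ∀ z ∈ neighbourhood d x, φ z ≤ φ y
  | none => ∀ z ∈ neighbourhood d x, φ z ≤ φ x

/-- A classical steep-ascent hill climber: a rule that takes a correct steep-ascent decision
at every bit string (rules differ only in how they break ties). -/
def IsSteepRule {n : ℕ} (φ : BitString n → ℝ) (d : ℕ)
    (s : BitString n → Option (BitString n)) : Prop :=
  ∀ x, IsSteepMove φ d x (s x)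

/-- The sequence of bit strings visited by the hill climber with rule `s` started at `x`, with at
most `T` iterations; an iteration is one application of the rule. -/
def classicalClimb {n : ℕ} (s : BitString n → Option (BitString n)) :
    ℕ → BitString n → List (BitString n)
  | 0, x => [x]
  | T + 1, x =>
    match s x with
    | none => [x]
    | some y => x :: classicalClimb s T y

/-! ### Quantum query algorithms -/

/-- Computational basis of an `n`-qubit index register, an answer qubit and a workspace
of dimension `w + 1`. -/
abbrev QBasis (n w : ℕ) : Type := BitString n × Bool × Fin (w + 1)

/-- A gate: a fixed unitary on all registers, or a query to the oracle `O_{f_y}`. -/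
inductive QGate (n w : ℕ) : Type
  | unitary (U : Matrix.unitaryGroup (QBasis n w) ℂ)
  | query (y : BitString n)

/-- Action of a gate on amplitudes, when the oracles are those of the marking functions `f y`;
the query with index `y` is `|x⟩|b⟩|v⟩ ↦ |x⟩|b ⊕ f_y(x)⟩|v⟩`. -/
noncomputable def QGate.apply {n w : ℕ} (f : BitString n → BitString n → Bool) :
    QGate n w → (QBasis n w → ℂ) → (QBasis n w → ℂ)
  | .unitary U, ψ => Matrix.mulVec (U : Matrix (QBasis n w) (QBasis n w) ℂ) ψ
  | .query y, ψ => fun b => ψ (b.1, xor b.2.1 (f y b.1), b.2.2)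

/-- Number of oracle queries made by a gate. -/
def QGate.queries {n w : ℕ} : QGate n w → ℕ
  | .unitary _ => 0
  | .query _ => 1

/-- The initial state `|0…0⟩|0⟩|0⟩`. -/
def initState (n w : ℕ) : QBasis n w → ℂ :=
  Pi.single (fun _ => false, false, 0) 1

/-- The state after applying the gates of the circuit `c`, from left to right. -/
noncomputable def circuitState {n w : ℕ} (f : BitString n → BitString n → Bool)
    (c : List (QGate n w)) : QBasis n w → ℂ :=
  c.foldl (fun ψ g => g.apply f ψ) (initState n w)

/-- Number of oracle queries made by a circuit. -/
def circuitQueries {n w : ℕ} (c : List (QGate n w)) : ℕ :=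
  (c.map QGate.queries).sum

theorem QGate.sum_sq_apply {n w : ℕ} (f : BitString n → BitString n → Bool)
    (g : QGate n w) (ψ : QBasis n w → ℂ) :
    ∑ b, ‖g.apply f ψ b‖ ^ 2 = ∑ b, ‖ψ b‖ ^ 2 := by
  cases g with
  | unitary U =>
    have key : ∀ v : QBasis n w → ℂ, ((∑ b, ‖v b‖ ^ 2 : ℝ) : ℂ) = star v ⬝ᵥ v := by
      intro v
      simp [dotProduct, Complex.conj_mul']
    have h : ((∑ b, ‖(QGate.unitary U).apply f ψ b‖ ^ 2 : ℝ) : ℂ)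
        = ((∑ b, ‖ψ b‖ ^ 2 : ℝ) : ℂ) := by
      rw [key, key]
      simp only [QGate.apply]
      rw [Matrix.star_mulVec, Matrix.dotProduct_mulVec, Matrix.vecMul_vecMul,
        ← Matrix.star_eq_conjTranspose, Matrix.mem_unitaryGroup_iff'.mp U.2, Matrix.vecMul_one]
    exact_mod_cast h
  | query y =>
    let e : QBasis n w ≃ QBasis n w :=
      { toFun := fun b => (b.1, xor b.2.1 (f y b.1), b.2.2)
        invFun := fun b => (b.1, xor b.2.1 (f y b.1), b.2.2)
        left_inv := fun b => by simp
        right_inv := fun b => by simp }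
    exact Equiv.sum_comp e (fun b => ‖ψ b‖ ^ 2)

theorem sum_sq_foldl {n w : ℕ} (f : BitString n → BitString n → Bool)
    (c : List (QGate n w)) (ψ : QBasis n w → ℂ) :
    ∑ b, ‖c.foldl (fun ψ g => g.apply f ψ) ψ b‖ ^ 2 = ∑ b, ‖ψ b‖ ^ 2 := by
  induction c generalizing ψ with
  | nil => rfl
  | cons g c ih => rw [List.foldl_cons, ih, QGate.sum_sq_apply]

theorem sum_sq_circuitState {n w : ℕ} (f : BitString n → BitString n → Bool)
    (c : List (QGate n w)) : ∑ b, ‖circuitState f c b‖ ^ 2 = 1 := by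
  rw [circuitState, sum_sq_foldl, Finset.sum_eq_single (fun _ => false, false, 0)]
  · simp [initState]
  · intro b _ hb
    simp [initState, hb]
  · simp

/-- Born rule: the distribution of the outcome when all registers are measured in the
computational basis at the end of the circuit. -/
noncomputable def circuitOutcome {n w : ℕ} (f : BitString n → BitString n → Bool)
    (c : List (QGate n w)) : PMF (QBasis n w) :=
  PMF.ofFintype (fun b => ENNReal.ofReal (‖circuitState f c b‖ ^ 2)) (by
    rw [← ENNReal.ofReal_sum_of_nonneg (fun _ _ => by positivity), sum_sq_circuitState,
      ENNReal.ofReal_one])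

/-- Adaptive quantum query algorithms with output in `α`. Such an algorithm may toss classical
coins, or run a quantum circuit on `|0…0⟩` and measure it, and continue depending on the result.
It is a syntactic object, which has access to the objective function only through queries. -/
inductive QAlg (n : ℕ) (α : Type) : Type
  | ret (a : α)
  | toss (m : ℕ) (next : Fin (m + 1) → QAlg n α)
  | circuit (w : ℕ) (c : List (QGate n w)) (next : QBasis n w → QAlg n α)

/-- Sequential composition. -/
def QAlg.bind {n : ℕ} {α β : Type} : QAlg n α → (α → QAlg n β) → QAlg n β
  | .ret a, F => F a
  | .toss m next, F => .toss m (fun i => (next i).bind F)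
  | .circuit w c next, F => .circuit w c (fun b => (next b).bind F)

/-- The joint distribution of the output and of the number of oracle queries made,
when the oracles are those of the marking functions `f y`. -/
noncomputable def QAlg.run {n : ℕ} {α : Type} (f : BitString n → BitString n → Bool) :
    QAlg n α → PMF (α × ℕ)
  | .ret a => PMF.pure (a, 0)
  | .toss m next => (PMF.uniformOfFintype (Fin (m + 1))).bind (fun i => (next i).run f)
  | .circuit _ c next => (circuitOutcome f c).bind
      (fun b => ((next b).run f).map (fun z => (z.1, z.2 + circuitQueries c)))

/-- The hill climber whose local search in the iteration number `t` at the current bit string `x`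
is the quantum subroutine `step t x`: if the subroutine returns a bit string, move there,
otherwise stop. There are at most `T` iterations, numbered from `t` on;
the output is the sequence of the bit strings visited. -/
def quantumClimb {n : ℕ} (step : ℕ → BitString n → QAlg n (Option (BitString n))) :
    (t T : ℕ) → BitString n → QAlg n (List (BitString n))
  | _, 0, x => .ret [x]
  | t, T + 1, x => (step t x).bind fun o =>
    match o with
    | none => .ret [x]
    | some y => (quantumClimb step (t + 1) T y).bind fun l => .ret (x :: l)

/-- The number of iterations made by a hill climber limited to `T` iterations that visited the
bit strings in the list `l`: one for each move, and a last one without a move unless the limit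
is reached. -/
def iterations {n : ℕ} (T : ℕ) (l : List (BitString n)) : ℕ := min l.length T

/-!
The local search at `x` is a maximum search in the style of Dürr and Høyer with a fixed number of
rounds. It keeps a current best string `y`, initially `x`, and in each round runs Grover's
algorithm on the neighbours of `x`, with those `z` marked that satisfy `φ z > φ y`; a marked
measurement result replaces `y`. There are at most `N ≤ (n + 1) ^ d` neighbours, and the number of
Grover iterations is uniform in `0, …, ⌊√N⌋`. Averaging `sin² ((2j + 1) θ)` over this range shows
that a round succeeds with probability at least `1 / 4` however many strings are marked
(`quarter_le_sum_sin_sq`), and then the result is uniformly distributed among the `r` marked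
strings, so that on average at most `r / 2` of them remain better. Hence a round multiplies the
expected number of better neighbours by at most `7 / 8` (`sum_meanProb_mul_card_le`), and after
`R` rounds a better neighbour is left with probability at most `(7 / 8) ^ R * N`
(`expect_searchRounds_le`).

In iteration `t`, a number of rounds logarithmic in `n t` makes this failure probability at most
`1 / (3 (t + 1) (t + 2))`. These bounds telescope, so the whole climb is correct with probability
at least `2 / 3` (`expect_quantumClimb_fail_le`). Correct decisions along the climb extend to a
rule on all strings since the objective increases strictly and no string is visited twice
(`IsSteepClimb.cons`). The number of queries in iteration `t` is at most
`R (⌊√N⌋ + 1) = O(n ^ (d / 2) log (n t + 2))` on every run (`maxQueries_le`), so the bound on the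
expected cost holds termwise.

Circuits need no decomposition into elementary gates: both the preparation of a state with real
amplitudes and Grover's diffusion are Householder reflections.
-/

/-! ### Semantics of query algorithms -/

theorem PMF.tsum_bind_mul {α β : Type*} (p : PMF α) (q : α → PMF β) (g : β → ℝ≥0∞) :
    ∑' b, p.bind q b * g b = ∑' a, p a * ∑' b, q a b * g b := by
  simp only [PMF.bind_apply, ← ENNReal.tsum_mul_right, ← ENNReal.tsum_mul_left, mul_assoc]
  exact ENNReal.tsum_comm

theorem PMF.tsum_pure_mul {α : Type*} (a : α) (g : α → ℝ≥0∞) :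
    ∑' b, PMF.pure a b * g b = g a := by
  rw [tsum_eq_single a]
  · simp
  · intro b hb
    simp [hb]

theorem PMF.tsum_map_mul {α β : Type*} (p : PMF α) (h : α → β) (g : β → ℝ≥0∞) :
    ∑' b, p.map h b * g b = ∑' a, p a * g (h a) := by
  rw [PMF.map, PMF.tsum_bind_mul]
  simp only [Function.comp_apply, PMF.tsum_pure_mul]

namespace QAlg

variable {n : ℕ} {α β : Type}

theorem run_bind (f : BitString n → BitString n → Bool) (A : QAlg n α) (F : α → QAlg n β) :
    (A.bind F).run f =
      (A.run f).bind fun z => ((F z.1).run f).map fun u => (u.1, u.2 + z.2) := by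
  induction A with
  | ret a =>
    simp only [QAlg.bind, QAlg.run, PMF.pure_bind, add_zero, Prod.mk.eta]
    exact (PMF.map_id _).symm
  | toss m next ih =>
    simp only [QAlg.bind, QAlg.run, ih, PMF.bind_bind]
  | circuit w c next ih =>
    simp only [QAlg.bind, QAlg.run, ih, PMF.bind_bind, PMF.map_bind, PMF.bind_map, PMF.map_comp]
    congr 1
    funext b
    congr 1
    funext z
    simp only [Function.comp_apply]
    congr 1
    funext u
    simp [add_assoc]

/-- The expected value of `g` at the output of the algorithm. -/
noncomputable def expect (f : BitString n → BitString n → Bool) (A : QAlg n α)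
    (g : α → ℝ≥0∞) : ℝ≥0∞ :=
  ∑' z, A.run f z * g z.1

variable (f : BitString n → BitString n → Bool)

theorem expect_mono (A : QAlg n α) {g h : α → ℝ≥0∞} (hgh : ∀ a, g a ≤ h a) :
    A.expect f g ≤ A.expect f h :=
  ENNReal.tsum_le_tsum fun z => mul_le_mul_right (hgh z.1) _

@[simp] theorem expect_ret (a : α) (g : α → ℝ≥0∞) : (ret a : QAlg n α).expect f g = g a := by
  simp only [expect, run, PMF.tsum_pure_mul]

theorem expect_const (A : QAlg n α) (c : ℝ≥0∞) : A.expect f (fun _ => c) = c := by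
  rw [expect, ENNReal.tsum_mul_right, PMF.tsum_coe, one_mul]

theorem expect_add (A : QAlg n α) (g h : α → ℝ≥0∞) :
    A.expect f (fun a => g a + h a) = A.expect f g + A.expect f h := by
  simp only [expect, mul_add, ENNReal.tsum_add]

theorem expect_bind (A : QAlg n α) (F : α → QAlg n β) (g : β → ℝ≥0∞) :
    (A.bind F).expect f g = A.expect f fun a => (F a).expect f g := by
  simp only [expect, run_bind, PMF.tsum_bind_mul, PMF.tsum_map_mul]

theorem expect_toss (m : ℕ) (next : Fin (m + 1) → QAlg n α) (g : α → ℝ≥0∞) :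
    (toss m next).expect f g = ∑ i, ((m + 1 : ℕ) : ℝ≥0∞)⁻¹ * (next i).expect f g := by
  simp only [expect, run, PMF.tsum_bind_mul, tsum_fintype, PMF.uniformOfFintype_apply,
    Fintype.card_fin]

theorem expect_circuit (w : ℕ) (c : List (QGate n w)) (next : QBasis n w → QAlg n α)
    (g : α → ℝ≥0∞) :
    (circuit w c next).expect f g =
      ∑ b, ENNReal.ofReal (‖circuitState f c b‖ ^ 2) * (next b).expect f g := by
  simp only [expect, run, PMF.tsum_bind_mul, PMF.tsum_map_mul, tsum_fintype, circuitOutcome,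
    PMF.ofFintype_apply]

open Classical in
/-- An algorithm whose failure probability is at most `1 / 3` succeeds with probability at
least `2 / 3`. -/
theorem two_thirds_le_of_expect_le (A : QAlg n α) (P : α → Prop)
    (h : A.expect f (fun a => if P a then 0 else 1) ≤ 3⁻¹) :
    2 / 3 ≤ (A.run f).toOuterMeasure {z | P z.1} := by
  have h1 : (A.run f).toOuterMeasure {z | P z.1} = A.expect f (fun a => if P a then 1 else 0) := by
    rw [PMF.toOuterMeasure_apply, expect]
    refine tsum_congr fun z => ?_
    by_cases hz : P z.1 <;> simp [hz]
  have h2 : A.expect f (fun a => if P a then 1 else 0) +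
      A.expect f (fun a => if P a then 0 else 1) = 1 := by
    rw [← expect_add]
    refine Eq.trans (congrArg _ ?_) (expect_const f A 1)
    funext a
    by_cases ha : P a <;> simp [ha]
  have h3 : (2 / 3 : ℝ≥0∞) + 3⁻¹ = 1 := by
    rw [← one_div, ENNReal.div_add_div_same, show (2 + 1 : ℝ≥0∞) = 3 by norm_num]
    exact ENNReal.div_self (by norm_num) (by norm_num)
  rw [h1]
  refine (ENNReal.add_le_add_iff_right (a := 3⁻¹) (by simp)).mp ?_
  rw [h3]
  exact h2.symm.trans_le (add_le_add le_rfl h)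

/-- The algorithm never makes more than `q` queries. -/
def QueriesLE (A : QAlg n α) (q : ℕ) : Prop :=
  ∀ z ∈ (A.run f).support, z.2 ≤ q

variable {f}

theorem QueriesLE.ret (a : α) : (ret a : QAlg n α).QueriesLE f 0 := by
  intro z hz
  simp only [run, PMF.support_pure, Set.mem_singleton_iff] at hz
  simp [hz]

theorem QueriesLE.toss {m : ℕ} {next : Fin (m + 1) → QAlg n α} {q : ℕ}
    (h : ∀ i, (next i).QueriesLE f q) : (toss m next).QueriesLE f q := by
  intro z hz
  simp only [run, PMF.mem_support_bind_iff] at hz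
  obtain ⟨i, -, hi⟩ := hz
  exact h i z hi

theorem QueriesLE.circuit {w : ℕ} {c : List (QGate n w)} {next : QBasis n w → QAlg n α} {q : ℕ}
    (h : ∀ b, (next b).QueriesLE f q) :
    (circuit w c next).QueriesLE f (q + circuitQueries c) := by
  intro z hz
  simp only [run, PMF.mem_support_bind_iff, PMF.mem_support_map_iff] at hz
  obtain ⟨b, -, u, hu, rfl⟩ := hz
  exact Nat.add_le_add_right (h b u hu) _

theorem mem_support_run_bind {A : QAlg n α} {F : α → QAlg n β} {z : β × ℕ}
    (hz : z ∈ ((A.bind F).run f).support) :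
    ∃ u ∈ (A.run f).support, ∃ v ∈ ((F u.1).run f).support, z = (v.1, v.2 + u.2) := by
  simp only [run_bind, PMF.mem_support_bind_iff, PMF.mem_support_map_iff] at hz
  obtain ⟨u, hu, v, hv, rfl⟩ := hz
  exact ⟨u, hu, v, hv, rfl⟩

theorem QueriesLE.bind {A : QAlg n α} {F : α → QAlg n β} {p q : ℕ} (hA : A.QueriesLE f p)
    (hF : ∀ a, (F a).QueriesLE f q) : (A.bind F).QueriesLE f (q + p) := by
  intro z hz
  obtain ⟨u, hu, v, hv, rfl⟩ := mem_support_run_bind hz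
  exact Nat.add_le_add (hF u.1 v hv) (hA u hu)

theorem QueriesLE.mono {A : QAlg n α} {p q : ℕ} (hA : A.QueriesLE f p) (h : p ≤ q) :
    A.QueriesLE f q := fun z hz => (hA z hz).trans h

end QAlg

/-! ### Hill climbers with unreliable local search -/

section Climb

variable {n d : ℕ} {φ : BitString n → ℝ}

theorem exists_isSteepMove (φ : BitString n → ℝ) (d : ℕ) (x : BitString n) :
    ∃ o, IsSteepMove φ d x o := by
  by_cases h : ∀ z ∈ neighbourhood d x, φ z ≤ φ x
  · exact ⟨none, h⟩
  · push Not at h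
    obtain ⟨z, hz, hlt⟩ := h
    obtain ⟨y, hy, hmax⟩ := (Set.toFinite (neighbourhood d x)).exists_maximalFor φ _ ⟨z, hz⟩
    have hmax' : ∀ u ∈ neighbourhood d x, φ u ≤ φ y := fun u hu =>
      (le_total (φ u) (φ y)).elim id (hmax hu)
    exact ⟨some y, hy, hlt.trans_le (hmax' z hz), hmax'⟩

theorem exists_isSteepRule (φ : BitString n → ℝ) (d : ℕ) : ∃ s, IsSteepRule φ d s :=
  Classical.axiomOfChoice (exists_isSteepMove φ d)

theorem IsSteepRule.update {s : BitString n → Option (BitString n)} (hs : IsSteepRule φ d s)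
    {x : BitString n} {o : Option (BitString n)} (ho : IsSteepMove φ d x o) :
    IsSteepRule φ d (Function.update s x o) := by
  intro z
  by_cases hz : z = x
  · subst hz
    simpa using ho
  · simpa [hz] using hs z

/-- The objective function increases strictly along a climb, so that the decision taken at a
string of lower value is irrelevant for the climb. -/
theorem classicalClimb_update {s : BitString n → Option (BitString n)} (hs : IsSteepRule φ d s)
    {x y : BitString n} (o : Option (BitString n)) (T : ℕ) (hxy : φ x < φ y) :
    classicalClimb (Function.update s x o) T y = classicalClimb s T y := by
  induction T generalizing y with
  | zero => rfl
  | succ T ih =>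
    have hne : y ≠ x := by
      rintro rfl
      exact lt_irrefl _ hxy
    have hy := hs y
    simp only [classicalClimb, Function.update_of_ne hne]
    cases hsy : s y with
    | none => rfl
    | some z =>
      rw [hsy] at hy
      simp only [ih (hxy.trans hy.2.1)]

/-- The list `l` is the sequence of bit strings visited by some classical steep hill climber. -/
def IsSteepClimb (φ : BitString n → ℝ) (d T : ℕ) (x : BitString n) (l : List (BitString n)) :
    Prop :=
  ∃ s, IsSteepRule φ d s ∧ l = classicalClimb s T x

theorem isSteepClimb_zero (x : BitString n) : IsSteepClimb φ d 0 x [x] := by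
  obtain ⟨s, hs⟩ := exists_isSteepRule φ d
  exact ⟨s, hs, rfl⟩

theorem isSteepClimb_stop {x : BitString n} (T : ℕ) (hx : IsSteepMove φ d x none) :
    IsSteepClimb φ d (T + 1) x [x] := by
  obtain ⟨s, hs⟩ := exists_isSteepRule φ d
  exact ⟨_, hs.update hx, by simp [classicalClimb]⟩

theorem IsSteepClimb.cons {x y : BitString n} {T : ℕ} {l : List (BitString n)}
    (hl : IsSteepClimb φ d T y l) (hx : IsSteepMove φ d x (some y)) :
    IsSteepClimb φ d (T + 1) x (x :: l) := by
  obtain ⟨s, hs, rfl⟩ := hl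
  exact ⟨_, hs.update hx, by simp [classicalClimb, classicalClimb_update hs _ T hx.2.1]⟩

variable {f : BitString n → BitString n → Bool}
  {step : ℕ → BitString n → QAlg n (Option (BitString n))}

open Classical in
/-- If the local search in iteration `t` fails with probability at most `1 / (3(t+1)(t+2))`, then
by telescoping the climb from iteration `t` on fails with probability at most `1 / (3(t+1))`. -/
theorem expect_quantumClimb_fail_le
    (hstep : ∀ t x, (step t x).expect f (fun o => if IsSteepMove φ d x o then 0 else 1) ≤
      ENNReal.ofReal (1 / (3 * (t + 1) * (t + 2))))
    (t T : ℕ) (x : BitString n) :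
    (quantumClimb step t T x).expect f (fun l => if IsSteepClimb φ d T x l then 0 else 1) ≤
      ENNReal.ofReal (1 / (3 * (t + 1))) := by
  induction T generalizing t x with
  | zero => simp [quantumClimb, isSteepClimb_zero]
  | succ T ih =>
    rw [quantumClimb, QAlg.expect_bind]
    refine (QAlg.expect_mono f _ (h := fun o => (if IsSteepMove φ d x o then 0 else 1) +
      ENNReal.ofReal (1 / (3 * ((t + 1 : ℕ) + 1)))) ?_).trans ?_
    · intro o
      by_cases ho : IsSteepMove φ d x o
      · simp only [ho, if_true, zero_add]
        cases o with
        | none => simp [isSteepClimb_stop T ho]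
        | some y =>
          simp only [QAlg.expect_bind, QAlg.expect_ret]
          refine (QAlg.expect_mono f _ fun l => ?_).trans (ih (t + 1) y)
          by_cases hl : IsSteepClimb φ d T y l
          · simp [hl, hl.cons ho]
          · simp only [hl, if_false]
            split_ifs <;> simp
      · simp only [ho, if_false]
        refine le_add_right ?_
        refine (QAlg.expect_mono f _ (h := fun _ => 1) fun l => ?_).trans
          (QAlg.expect_const f _ 1).le
        split_ifs <;> simp
    · rw [QAlg.expect_add, QAlg.expect_const]
      refine (add_le_add (hstep t x) le_rfl).trans ?_
      rw [← ENNReal.ofReal_add (by positivity) (by positivity)]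
      refine ENNReal.ofReal_le_ofReal (le_of_eq ?_)
      push_cast
      field_simp
      ring

/-- If the local search in iteration `t` makes at most `B t` queries, then on every run the
climb makes at most as many queries as these bounds add up to. -/
theorem queries_quantumClimb_le {B : ℕ → ℕ} (hB : ∀ t x, (step t x).QueriesLE f (B t))
    (t T : ℕ) (x : BitString n) :
    ∀ z ∈ ((quantumClimb step t T x).run f).support,
      z.2 ≤ ∑ i ∈ Finset.range (iterations T z.1), B (t + i) := by
  induction T generalizing t x with
  | zero =>
    intro z hz
    exact (QAlg.QueriesLE.ret _ z hz).trans (Nat.zero_le _)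
  | succ T ih =>
    intro z hz
    rw [quantumClimb] at hz
    obtain ⟨u, hu, v, hv, rfl⟩ := QAlg.mem_support_run_bind hz
    have hu' := hB t x u hu
    cases ho : u.1 with
    | none =>
      simp only [ho, QAlg.run, PMF.support_pure, Set.mem_singleton_iff] at hv
      subst hv
      simpa [iterations] using hu'
    | some y =>
      simp only [ho] at hv
      obtain ⟨u', hu1, v', hv', rfl⟩ := QAlg.mem_support_run_bind hv
      simp only [QAlg.run, PMF.support_pure, Set.mem_singleton_iff] at hv'
      subst hv'
      have h := ih (t + 1) y u' hu1
      have hit : iterations (T + 1) (x :: u'.1) = iterations T u'.1 + 1 := by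
        simp [iterations]
      simp only [hit, Finset.sum_range_succ', add_zero, zero_add]
      refine Nat.add_le_add (h.trans (le_of_eq ?_)) hu'
      exact Finset.sum_congr rfl fun i _ => congrArg B (by omega)

end Climb

/-! ### Householder reflections -/

section Householder

variable {B : Type*} [Fintype B] [DecidableEq B]

/-- The reflection `ψ ↦ ψ - 2 ⟨u, ψ⟩ u / ⟨u, u⟩` in the hyperplane orthogonal to the real
vector `u` (the identity for `u = 0`), as a complex matrix. -/
noncomputable def householderMatrix (u : B → ℝ) : Matrix B B ℂ :=
  (1 - (2 / (u ⬝ᵥ u)) • Matrix.vecMulVec u u).map ((↑) : ℝ → ℂ)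

theorem householderMatrix_mulVec (u ψ : B → ℝ) :
    (householderMatrix u).mulVec (fun b => (ψ b : ℂ)) =
      fun b => ((ψ b - 2 / (u ⬝ᵥ u) * (u ⬝ᵥ ψ) * u b : ℝ) : ℂ) := by
  have h : (1 - (2 / (u ⬝ᵥ u)) • Matrix.vecMulVec u u).mulVec ψ =
      fun b => ψ b - 2 / (u ⬝ᵥ u) * (u ⬝ᵥ ψ) * u b := by
    rw [Matrix.sub_mulVec, Matrix.one_mulVec, Matrix.smul_mulVec, Matrix.vecMulVec_mulVec]
    funext b
    simp
    ring
  funext b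
  rw [← congrFun h b]
  simp [householderMatrix, Matrix.mulVec, dotProduct]

theorem householderMatrix_mem (u : B → ℝ) : householderMatrix u ∈ Matrix.unitaryGroup B ℂ := by
  rw [Matrix.mem_unitaryGroup_iff]
  set A : Matrix B B ℝ := 1 - (2 / (u ⬝ᵥ u)) • Matrix.vecMulVec u u with hA
  have hstar : star (householderMatrix u) = householderMatrix u := by
    ext i j
    simp [householderMatrix, Matrix.star_apply, Matrix.vecMulVec_apply, Matrix.one_apply,
      mul_comm, eq_comm]
  have hmul : A * A = 1 := by
    have h2 : Matrix.vecMulVec u u * Matrix.vecMulVec u u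
        = (u ⬝ᵥ u) • Matrix.vecMulVec u u := by
      rw [Matrix.vecMulVec_mul_vecMulVec]
      ext i j
      simp [Matrix.vecMulVec_apply]
      ring
    rw [hA, sub_mul, mul_sub, mul_sub, one_mul, mul_one, smul_mul_smul_comm, h2, smul_smul,
      one_mul]
    by_cases hu : u ⬝ᵥ u = 0
    · simp [hu]
    · have : 2 / (u ⬝ᵥ u) * (2 / (u ⬝ᵥ u)) * (u ⬝ᵥ u) = 2 / (u ⬝ᵥ u) + 2 / (u ⬝ᵥ u) := by
        field_simp
        ring
      rw [this, add_smul]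
      abel
  have hmap : householderMatrix u = (Complex.ofRealHom.mapMatrix) A := rfl
  rw [hstar, hmap, ← map_mul, hmul, map_one]

/-- The Householder reflection as a unitary. -/
noncomputable def householder (u : B → ℝ) : Matrix.unitaryGroup B ℂ :=
  ⟨householderMatrix u, householderMatrix_mem u⟩

/-- The reflection along the difference of two real unit vectors exchanges them. -/
theorem householderMatrix_sub_mulVec {u v : B → ℝ} (hu : u ⬝ᵥ u = 1) (hv : v ⬝ᵥ v = 1) :
    (householderMatrix (u - v)).mulVec (fun b => (u b : ℂ)) = fun b => (v b : ℂ) := by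
  rw [householderMatrix_mulVec]
  funext b
  have h1 : (u - v) ⬝ᵥ (u - v) = 2 * ((u - v) ⬝ᵥ u) := by
    rw [sub_dotProduct, dotProduct_sub, dotProduct_sub, sub_dotProduct, hu, hv,
      dotProduct_comm v u]
    ring
  by_cases h0 : (u - v) ⬝ᵥ u = 0
  · rw [h0, mul_zero] at h1
    have hb := congrFun (dotProduct_self_eq_zero.mp h1) b
    simp only [Pi.sub_apply, Pi.zero_apply] at hb
    rw [h0, mul_zero, zero_mul, sub_zero, sub_eq_zero.mp hb]
  · rw [h1]
    congr 1
    field_simp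
    simp

end Householder

/-! ### Grover search with real starting amplitudes -/

section Grover

variable {n : ℕ}

/-- The computational basis state with index register `z` and the other registers zero. -/
noncomputable def basisVec (z : BitString n) : QBasis n 0 → ℝ := Pi.single (z, false, 0) 1

/-- The index register with the amplitudes `v`, the answer qubit in the
state `(|0⟩ - |1⟩) / √2`. -/
noncomputable def searchVec (v : BitString n → ℝ) : QBasis n 0 → ℝ :=
  fun b => v b.1 * (if b.2.1 then -√(1 / 2) else √(1 / 2))

theorem basisVec_dotProduct_self (z : BitString n) : basisVec z ⬝ᵥ basisVec z = 1 := by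
  simp [basisVec]

theorem initState_eq_basisVec :
    initState n 0 = fun b => ((basisVec (fun _ => false) b : ℝ) : ℂ) := by
  funext b
  by_cases h : b = (fun _ => false, false, 0)
  · simp [initState, basisVec, h]
  · simp [initState, basisVec, h]

theorem sum_qBasis (g : QBasis n 0 → ℝ) : ∑ b, g b = ∑ z, (g (z, true, 0) + g (z, false, 0)) := by
  simp [Fintype.sum_prod_type]

theorem searchVec_dotProduct_self {v : BitString n → ℝ} (hv : ∑ z, v z ^ 2 = 1) :
    searchVec v ⬝ᵥ searchVec v = 1 := by
  rw [dotProduct, sum_qBasis, ← hv]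
  refine Finset.sum_congr rfl fun z _ => ?_
  have h : √(1 / 2) * √(1 / 2) = (1 / 2 : ℝ) := Real.mul_self_sqrt (by norm_num)
  simp only [searchVec, if_true, Bool.false_eq_true, if_false]
  linear_combination 2 * v z ^ 2 * h

/-- Grover's algorithm with `j` iterations: preparation of the state with amplitudes `v`, then
alternately a query and the reflection along this state. -/
noncomputable def groverCircuit (v : BitString n → ℝ) (y : BitString n) : ℕ → List (QGate n 0)
  | 0 => [.unitary (householder (basisVec (fun _ => false) - searchVec v))]
  | j + 1 => groverCircuit v y j ++ [.query y, .unitary (householder (searchVec v))]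

theorem circuitQueries_groverCircuit (v : BitString n → ℝ) (y : BitString n) (j : ℕ) :
    circuitQueries (groverCircuit v y j) = j := by
  induction j with
  | zero => simp [groverCircuit, circuitQueries, QGate.queries]
  | succ j ih =>
    rw [groverCircuit, circuitQueries, List.map_append, List.sum_append, ← circuitQueries, ih]
    simp [QGate.queries]

/-- After `j` iterations the state is the rotation of the starting state by the angle `2jθ` in
the plane spanned by its marked and its unmarked part, where `sin² θ` is the probability of the
marked strings at the start. The sign comes from the Householder reflection, which negates the starting
state where Grover's diffusion fixes it. -/
theorem circuitState_groverCircuit (f : BitString n → BitString n → Bool) (y : BitString n)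
    {v : BitString n → ℝ} (hv : ∑ z, v z ^ 2 = 1) {θ : ℝ}
    (hθ : ∑ z, (if f y z then v z ^ 2 else 0) = Real.sin θ ^ 2)
    (hs : Real.sin θ ≠ 0) (hc : Real.cos θ ≠ 0) (j : ℕ) :
    circuitState f (groverCircuit v y j) = fun b =>
      (((-1) ^ j * (if f y b.1 then Real.sin ((2 * j + 1) * θ) / Real.sin θ
        else Real.cos ((2 * j + 1) * θ) / Real.cos θ) * searchVec v b : ℝ) : ℂ) := by
  induction j with
  | zero =>
    simp only [circuitState, groverCircuit, List.foldl_cons, List.foldl_nil, QGate.apply,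
      householder, initState_eq_basisVec]
    rw [householderMatrix_sub_mulVec (basisVec_dotProduct_self _) (searchVec_dotProduct_self hv)]
    funext b
    congr 1
    split_ifs <;> simp [hs, hc]
  | succ j ih =>
    rw [groverCircuit, circuitState, List.foldl_append, ← circuitState, ih]
    simp only [List.foldl_cons, List.foldl_nil, QGate.apply, householder]
    rw [householderMatrix_mulVec, searchVec_dotProduct_self hv]
    set α : ℝ := Real.sin ((2 * j + 1) * θ) / Real.sin θ with hα
    set β : ℝ := Real.cos ((2 * j + 1) * θ) / Real.cos θ with hβ
    have hflip : ∀ b : QBasis n 0, searchVec v (b.1, xor b.2.1 (f y b.1), b.2.2) =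
        (if f y b.1 then -1 else 1) * searchVec v b := by
      rintro ⟨z, b, w⟩
      simp only [searchVec]
      cases b <;> cases f y z <;> simp
    have hcosq : Real.cos θ ^ 2 = 1 - Real.sin θ ^ 2 := Real.cos_sq' θ
    have hinner : (searchVec v ⬝ᵥ fun b : QBasis n 0 =>
        (-1) ^ j * (if f y b.1 then α else β) *
          searchVec v (b.1, xor b.2.1 (f y b.1), b.2.2)) =
        (-1) ^ j * (β * Real.cos θ ^ 2 - α * Real.sin θ ^ 2) := by
      have hr : β * Real.cos θ ^ 2 - α * Real.sin θ ^ 2 =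
          ∑ z, (β * v z ^ 2 - (α + β) * (if f y z then v z ^ 2 else 0)) := by
        rw [Finset.sum_sub_distrib, ← Finset.mul_sum, ← Finset.mul_sum, hv, hθ, hcosq]
        ring
      simp only [hflip]
      rw [hr, dotProduct, sum_qBasis, Finset.mul_sum]
      refine Finset.sum_congr rfl fun z _ => ?_
      have h : √(1 / 2) * √(1 / 2) = (1 / 2 : ℝ) := Real.mul_self_sqrt (by norm_num)
      simp only [searchVec, if_true, Bool.false_eq_true, if_false]
      split_ifs
      · linear_combination (-2 * (-1) ^ j * α * v z ^ 2) * h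
      · linear_combination (2 * (-1) ^ j * β * v z ^ 2) * h
    rw [hinner]
    funext b
    congr 1
    rw [hflip]
    have hang : (2 * ((j + 1 : ℕ) : ℝ) + 1) * θ = (2 * j + 1) * θ + 2 * θ := by
      push_cast
      ring
    have hαs : α * Real.sin θ = Real.sin ((2 * j + 1) * θ) := div_mul_cancel₀ _ hs
    have hβc : β * Real.cos θ = Real.cos ((2 * j + 1) * θ) := div_mul_cancel₀ _ hc
    rw [hang, Real.sin_add, Real.cos_add, ← hαs, ← hβc, Real.sin_two_mul, Real.cos_two_mul]
    split_ifs
    · have : (α * Real.sin θ * (2 * Real.cos θ ^ 2 - 1) +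
          β * Real.cos θ * (2 * Real.sin θ * Real.cos θ)) / Real.sin θ =
          α * (2 * Real.cos θ ^ 2 - 1) + 2 * β * Real.cos θ ^ 2 := by
        field_simp
      rw [this, pow_succ]
      linear_combination (2 * (-1) ^ j * α * searchVec v b) * hcosq
    · have : (β * Real.cos θ * (2 * Real.cos θ ^ 2 - 1) -
          α * Real.sin θ * (2 * Real.sin θ * Real.cos θ)) / Real.cos θ =
          β * (2 * Real.cos θ ^ 2 - 1) - 2 * α * Real.sin θ ^ 2 := by
        field_simp
      rw [this, pow_succ]
      ring

/-- The probability that the index register is measured in the state `z`. -/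
noncomputable def groverProb (f : BitString n → BitString n → Bool) (v : BitString n → ℝ)
    (y : BitString n) (j : ℕ) (z : BitString n) : ℝ :=
  ‖circuitState f (groverCircuit v y j) (z, true, 0)‖ ^ 2 +
    ‖circuitState f (groverCircuit v y j) (z, false, 0)‖ ^ 2

theorem groverProb_nonneg (f : BitString n → BitString n → Bool) (v : BitString n → ℝ)
    (y : BitString n) (j : ℕ) (z : BitString n) : 0 ≤ groverProb f v y j z := by
  unfold groverProb
  positivity

theorem sum_groverProb (f : BitString n → BitString n → Bool) (v : BitString n → ℝ)
    (y : BitString n) (j : ℕ) : ∑ z, groverProb f v y j z = 1 := by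
  rw [← sum_sq_circuitState f (groverCircuit v y j), sum_qBasis]
  rfl

theorem groverProb_of_marked (f : BitString n → BitString n → Bool) (y : BitString n)
    {v : BitString n → ℝ} (hv : ∑ z, v z ^ 2 = 1) {θ : ℝ}
    (hθ : ∑ z, (if f y z then v z ^ 2 else 0) = Real.sin θ ^ 2)
    (hs : Real.sin θ ≠ 0) (hc : Real.cos θ ≠ 0) (j : ℕ) {z : BitString n} (hz : f y z = true) :
    groverProb f v y j z = Real.sin ((2 * j + 1) * θ) ^ 2 * (v z ^ 2 / Real.sin θ ^ 2) := by
  have h : √(1 / 2) * √(1 / 2) = (1 / 2 : ℝ) := Real.mul_self_sqrt (by norm_num)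
  rw [groverProb, circuitState_groverCircuit f y hv hθ hs hc]
  simp only [hz, if_true, Complex.norm_real, Real.norm_eq_abs, sq_abs, searchVec,
    Bool.false_eq_true, if_false, mul_pow, neg_sq, ← pow_mul, div_pow]
  have h1 : (-1 : ℝ) ^ (j * 2) = 1 := by
    rw [mul_comm, pow_mul]
    simp
  rw [h1]
  linear_combination (2 * (Real.sin ((2 * j + 1) * θ) ^ 2 * (v z ^ 2 / Real.sin θ ^ 2))) * h

theorem sum_sin_sq_odd_mul (θ : ℝ) (m : ℕ) :
    4 * Real.sin (2 * θ) * ∑ j ∈ Finset.range m, Real.sin ((2 * j + 1) * θ) ^ 2 =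
      2 * m * Real.sin (2 * θ) - Real.sin (4 * m * θ) := by
  induction m with
  | zero => simp
  | succ m ih =>
    have h1 : 4 * ((m + 1 : ℕ) : ℝ) * θ = 2 * ((2 * m + 1) * θ) + 2 * θ := by
      push_cast
      ring
    have h2 : 4 * (m : ℝ) * θ = 2 * ((2 * m + 1) * θ) - 2 * θ := by ring
    rw [Finset.sum_range_succ, mul_add, ih, h1, h2, Real.sin_add, Real.sin_sub,
      Real.cos_two_mul ((2 * m + 1) * θ)]
    push_cast
    linear_combination (4 * Real.sin (2 * θ)) * Real.sin_sq_add_cos_sq ((2 * m + 1) * θ)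

/-- With a random number of iterations below `m ≥ 1 / sin 2θ`, Grover's algorithm succeeds with
probability at least `1 / 4`. -/
theorem quarter_le_sum_sin_sq {θ : ℝ} {m : ℕ} (h0 : 0 < Real.sin (2 * θ))
    (hm : 1 ≤ m * Real.sin (2 * θ)) :
    (m : ℝ) / 4 ≤ ∑ j ∈ Finset.range m, Real.sin ((2 * j + 1) * θ) ^ 2 := by
  have h := sum_sin_sq_odd_mul θ m
  have h1 := Real.sin_le_one (4 * m * θ)
  refine le_of_mul_le_mul_left ?_ (mul_pos four_pos h0)
  rw [h]
  linarith

/-! ### Comparison of two strings -/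

/-- A query at the string `z`. -/
noncomputable def compareCircuit (y z : BitString n) : List (QGate n 0) :=
  [.unitary (householder (basisVec (fun _ => false) - basisVec z)), .query y]

theorem circuitState_compareCircuit (f : BitString n → BitString n → Bool) (y z : BitString n) :
    circuitState f (compareCircuit y z) = Pi.single (z, f y z, 0) 1 := by
  simp only [circuitState, compareCircuit, List.foldl_cons, List.foldl_nil, QGate.apply,
    householder, initState_eq_basisVec]
  rw [householderMatrix_sub_mulVec (basisVec_dotProduct_self _) (basisVec_dotProduct_self _)]
  funext b
  obtain ⟨u, b, w⟩ := b
  simp only [basisVec, Pi.single_apply, Prod.mk.injEq]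
  by_cases hu : u = z
  · subst hu
    cases b <;> cases f y u <;> by_cases hw : w = 0 <;> simp [hw]
  · simp [hu]

end Grover

/-! ### Neighbourhoods -/

section Neighbours

variable {n : ℕ}

/-- The neighbourhood of `x` as a finset. -/
def neighbours (d : ℕ) (x : BitString n) : Finset (BitString n) :=
  {y | y ≠ x ∧ hammingDist x y ≤ d}

theorem mem_neighbours {d : ℕ} {x y : BitString n} :
    y ∈ neighbours d x ↔ y ∈ neighbourhood d x := by
  simp [neighbours, neighbourhood]

/-- An upper bound for the number of neighbours. It vanishes for `n = 0`, where there are no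
neighbours and no queries may be spent. -/
def maxNeighbours (n d : ℕ) : ℕ := if n = 0 then 0 else (n + 1) ^ d

/-- A neighbour arises by flipping the bits at `d` positions, where each position may be
left out. -/
theorem card_neighbours_le (d : ℕ) (x : BitString n) :
    (neighbours d x).card ≤ maxNeighbours n d := by
  unfold maxNeighbours
  split_ifs with hn
  · subst hn
    rw [Nat.le_zero, Finset.card_eq_zero, Finset.eq_empty_iff_forall_notMem]
    intro y hy
    exact (mem_neighbours.mp hy).1 (Subsingleton.elim _ _)
  · let flip : (Fin d → Option (Fin n)) → BitString n := fun g i =>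
      if ∃ k, g k = some i then !x i else x i
    have hsub : neighbours d x ⊆ Finset.univ.image flip := by
      intro y hy
      have hd := (mem_neighbours.mp hy).2
      set D : Finset (Fin n) := {i | x i ≠ y i} with hD
      have hcard : D.card ≤ d := hd
      refine Finset.mem_image.mpr ⟨fun k => if h : (k : ℕ) < D.card then
        some (D.equivFin.symm ⟨k, h⟩ : Fin n) else none, Finset.mem_univ _, ?_⟩
      funext i
      have hiff : (∃ k : Fin d, (if h : (k : ℕ) < D.card then
          some (D.equivFin.symm ⟨k, h⟩ : Fin n) else none) = some i) ↔ i ∈ D := by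
        constructor
        · rintro ⟨k, hk⟩
          split_ifs at hk with h
          rw [← Option.some.inj hk]
          exact (D.equivFin.symm ⟨k, h⟩).2
        · intro hi
          have hlt := (D.equivFin ⟨i, hi⟩).2
          exact ⟨⟨D.equivFin ⟨i, hi⟩, hlt.trans_le hcard⟩, by simp⟩
      simp only [flip, hiff]
      by_cases hi : i ∈ D
      · rw [if_pos hi]
        have : x i ≠ y i := by simpa [hD] using hi
        cases hx : x i <;> cases hy : y i <;> simp_all
      · rw [if_neg hi]
        simpa [hD] using hi
    calc (neighbours d x).card ≤ _ := Finset.card_le_card hsub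
      _ ≤ _ := Finset.card_image_le
      _ = (n + 1) ^ d := by simp

/-- The neighbours of `x` with a larger value than `y`. -/
noncomputable def betterNeighbours (φ : BitString n → ℝ) (d : ℕ) (x y : BitString n) :
    Finset (BitString n) :=
  {z ∈ neighbours d x | φ y < φ z}

variable {φ : BitString n → ℝ} {d : ℕ} {x y z : BitString n}

theorem mem_betterNeighbours :
    z ∈ betterNeighbours φ d x y ↔ z ∈ neighbours d x ∧ φ y < φ z := by
  simp [betterNeighbours]

/-- An element of a finite set is exceeded by at most half of the elements on average: of two
elements at most one exceeds the other. -/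
theorem two_mul_sum_card_betterNeighbours_le :
    2 * ∑ z ∈ betterNeighbours φ d x y, (betterNeighbours φ d x z).card ≤
      (betterNeighbours φ d x y).card ^ 2 := by
  set S := betterNeighbours φ d x y with hS
  have h1 : ∀ z ∈ S, (betterNeighbours φ d x z).card = ∑ u ∈ S, if φ z < φ u then 1 else 0 := by
    intro z hz
    rw [Finset.sum_boole, Nat.cast_id]
    congr 1
    ext u
    simp only [hS, mem_betterNeighbours, Finset.mem_filter] at hz ⊢
    exact ⟨fun h => ⟨⟨h.1, hz.2.trans h.2⟩, h.2⟩, fun h => ⟨h.1.1, h.2⟩⟩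
  rw [Finset.sum_congr rfl h1, two_mul]
  nth_rewrite 2 [Finset.sum_comm]
  rw [← Finset.sum_add_distrib]
  calc _ = ∑ z ∈ S, ∑ u ∈ S, ((if φ z < φ u then 1 else 0) + if φ u < φ z then 1 else 0) :=
        Finset.sum_congr rfl fun z _ => Finset.sum_add_distrib.symm
    _ ≤ ∑ z ∈ S, ∑ u ∈ S, 1 := by
        refine Finset.sum_le_sum fun z _ => Finset.sum_le_sum fun u _ => ?_
        split_ifs with h h' <;> first | omega | exact absurd h' h.not_gt
    _ = S.card ^ 2 := by simp [sq]

end Neighbours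

/-! ### One round of the search -/

section Round

variable {n : ℕ} {φ : BitString n → ℝ} {d : ℕ} {x y : BitString n}

/-- The starting amplitudes of the search at `x`: half of the probability is on `x`, which is
never marked, and half is spread uniformly over the neighbours. The first half ensures that at
most half of the probability is marked. -/
noncomputable def searchAmp (d : ℕ) (x z : BitString n) : ℝ :=
  if z = x then √(1 / 2) else if z ∈ neighbours d x then √(1 / (2 * (neighbours d x).card)) else 0

theorem searchAmp_sq_of_mem {z : BitString n} (hz : z ∈ neighbours d x) :
    searchAmp d x z ^ 2 = 1 / (2 * (neighbours d x).card) := by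
  rw [searchAmp, if_neg (mem_neighbours.mp hz).1, if_pos hz, Real.sq_sqrt (by positivity)]

theorem sum_searchAmp_sq (hN : 0 < (neighbours d x).card) : ∑ z, searchAmp d x z ^ 2 = 1 := by
  have hx : x ∉ neighbours d x := fun h => (mem_neighbours.mp h).1 rfl
  rw [← Finset.sum_subset (Finset.subset_univ (insert x (neighbours d x))),
    Finset.sum_insert hx, Finset.sum_congr rfl fun z hz => searchAmp_sq_of_mem hz]
  · have : ((neighbours d x).card : ℝ) ≠ 0 := by positivity
    rw [searchAmp, if_pos rfl, Real.sq_sqrt (by norm_num), Finset.sum_const, nsmul_eq_mul]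
    field_simp
    norm_num
  · intro z _ hz
    rw [Finset.mem_insert, not_or] at hz
    simp [searchAmp, hz.1, hz.2]

theorem sum_marked_searchAmp_sq (hxy : φ x ≤ φ y) :
    ∑ z, (if markFun φ y z then searchAmp d x z ^ 2 else 0) =
      (betterNeighbours φ d x y).card / (2 * (neighbours d x).card) := by
  rw [← Finset.sum_subset (Finset.subset_univ (betterNeighbours φ d x y))]
  · rw [Finset.sum_congr rfl (g := fun _ => 1 / (2 * ((neighbours d x).card : ℝ)))]
    · rw [Finset.sum_const, nsmul_eq_mul]
      ring
    · intro z hz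
      rw [mem_betterNeighbours] at hz
      simp [markFun, hz.2, searchAmp_sq_of_mem hz.1]
  · intro z _ hz
    rw [mem_betterNeighbours, not_and] at hz
    by_cases hm : φ y < φ z
    · have hzx : z ≠ x := by
        rintro rfl
        exact hm.not_ge hxy
      have hzn : z ∉ neighbours d x := fun h => hz h hm
      simp [searchAmp, hzx, hzn]
    · simp [markFun, hm]

/-- The probability of the measurement result `z` of Grover's algorithm when the number of
iterations is chosen uniformly from `0, …, m`. -/
noncomputable def meanProb (φ : BitString n → ℝ) (d m : ℕ) (x y z : BitString n) : ℝ :=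
  ∑ j : Fin (m + 1), ((m + 1 : ℕ) : ℝ)⁻¹ * groverProb (markFun φ) (searchAmp d x) y j z

theorem sum_meanProb (m : ℕ) : ∑ z, meanProb φ d m x y z = 1 := by
  simp only [meanProb]
  rw [Finset.sum_comm]
  simp only [← Finset.mul_sum, sum_groverProb, Finset.sum_const, Finset.card_univ,
    Fintype.card_fin, nsmul_eq_mul, mul_one]
  exact mul_inv_cancel₀ (by positivity)

/-- With about `√N` iterations at most, some better neighbour is found with probability at least
`1 / 4`, and all of them with equal probabilities. -/
theorem exists_meanProb_eq {m : ℕ} (hm : (neighbours d x).card ≤ (m + 1) ^ 2) (hxy : φ x ≤ φ y)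
    (hr : 0 < (betterNeighbours φ d x y).card) :
    ∃ a : ℝ, (∀ z ∈ betterNeighbours φ d x y, meanProb φ d m x y z = a) ∧
      1 / 4 ≤ a * (betterNeighbours φ d x y).card := by
  set r := (betterNeighbours φ d x y).card with hr_def
  set N := (neighbours d x).card with hN_def
  have hrN : r ≤ N := Finset.card_le_card (Finset.filter_subset _ _)
  have hN : 0 < N := hr.trans_le hrN
  have hr' : (1 : ℝ) ≤ r := by exact_mod_cast hr
  have hN' : (0 : ℝ) < N := by exact_mod_cast hN
  have hrN' : (r : ℝ) ≤ N := by exact_mod_cast hrN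
  set p : ℝ := r / (2 * N) with hp
  have hp0 : 1 / (2 * N) ≤ p := div_le_div_of_nonneg_right hr' (by positivity)
  have hp1 : p ≤ 1 / 2 := by
    rw [hp, div_le_div_iff₀ (by positivity) (by norm_num)]
    linarith
  have hppos : 0 < p := lt_of_lt_of_le (by positivity) hp0
  set θ := Real.arcsin √p with hθ
  have hsin : Real.sin θ = √p :=
    Real.sin_arcsin (by linarith [Real.sqrt_nonneg p]) (Real.sqrt_le_one.mpr (by linarith))
  have hcos : Real.cos θ = √(1 - p) := by rw [hθ, Real.cos_arcsin, Real.sq_sqrt hppos.le]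
  have hs : 0 < Real.sin θ := by
    rw [hsin]
    exact Real.sqrt_pos.mpr hppos
  have hc : 0 < Real.cos θ := by
    rw [hcos]
    exact Real.sqrt_pos.mpr (by linarith)
  have hsq : Real.sin θ ^ 2 = p := by rw [hsin, Real.sq_sqrt hppos.le]
  have hcq : Real.cos θ ^ 2 = 1 - p := by rw [hcos, Real.sq_sqrt (by linarith)]
  have hs2 : 0 < Real.sin (2 * θ) := by
    rw [Real.sin_two_mul]
    positivity
  have hs2q : 1 / N ≤ Real.sin (2 * θ) ^ 2 := by
    have h1 : Real.sin (2 * θ) ^ 2 = 4 * (p * (1 - p)) := by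
      rw [Real.sin_two_mul, mul_pow, mul_pow, hsq, hcq]
      ring
    have h2 : 1 / (2 * N) * (1 / 2) ≤ p * (1 - p) :=
      mul_le_mul hp0 (by linarith) (by norm_num) hppos.le
    rw [h1]
    calc (1 / N : ℝ) = 4 * (1 / (2 * N) * (1 / 2)) := by ring
      _ ≤ _ := by linarith
  have hlarge : (1 : ℝ) ≤ (m + 1 : ℕ) * Real.sin (2 * θ) := by
    have hm' : (N : ℝ) ≤ ((m + 1 : ℕ) : ℝ) ^ 2 := by exact_mod_cast hm
    refine (one_le_sq_iff₀ (by positivity)).mp ?_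
    rw [mul_pow]
    calc (1 : ℝ) = N * (1 / N) := by field_simp
      _ ≤ _ := mul_le_mul hm' hs2q (by positivity) (by positivity)
  have hsum := quarter_le_sum_sin_sq hs2 hlarge
  set s := ∑ j ∈ Finset.range (m + 1), Real.sin ((2 * j + 1) * θ) ^ 2 with hs_def
  refine ⟨((m + 1 : ℕ) : ℝ)⁻¹ * s * (1 / r), fun z hz => ?_, ?_⟩
  · rw [mem_betterNeighbours] at hz
    have hmark : markFun φ y z = true := by simp [markFun, hz.2]
    rw [meanProb, hs_def, ← Finset.mul_sum, mul_assoc, Finset.sum_mul,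
      ← Fin.sum_univ_eq_sum_range (fun j => Real.sin ((2 * j + 1) * θ) ^ 2 * (1 / r)) (m + 1)]
    congr 1
    refine Finset.sum_congr rfl fun j _ => ?_
    rw [groverProb_of_marked (markFun φ) y (sum_searchAmp_sq hN)
      ((sum_marked_searchAmp_sq hxy).trans hsq.symm) hs.ne' hc.ne' j hmark,
      searchAmp_sq_of_mem hz.1, hsq, hp, ← hN_def]
    congr 1
    field_simp
  · rw [mul_assoc, one_div_mul_cancel (by positivity), mul_one]
    rw [inv_mul_eq_div, div_le_div_iff₀ (by norm_num) (by positivity)]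
    linarith

open Classical in
/-- The current best string `y` is replaced by the measurement result `z` if this is a better
neighbour. -/
noncomputable def improve (φ : BitString n → ℝ) (d : ℕ) (x y z : BitString n) : BitString n :=
  if z ∈ betterNeighbours φ d x y then z else y

/-- One round decreases the expected number of better neighbours by a constant factor: with
probability at least `1 / 4` a better neighbour is found, and then at most half of the better
neighbours remain on average. -/
theorem sum_meanProb_mul_card_le {m : ℕ} (hm : (neighbours d x).card ≤ (m + 1) ^ 2)
    (hxy : φ x ≤ φ y) :
    ∑ z, meanProb φ d m x y z * (betterNeighbours φ d x (improve φ d x y z)).card ≤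
      7 / 8 * (betterNeighbours φ d x y).card := by
  set S := betterNeighbours φ d x y with hS
  rcases Nat.eq_zero_or_pos S.card with h0 | hr
  · have hS0 : S = ∅ := Finset.card_eq_zero.mp h0
    refine le_of_eq ?_
    rw [h0]
    refine (Finset.sum_eq_zero fun z _ => ?_).trans (by simp)
    simp [improve, ← hS, hS0]
  · obtain ⟨a, ha, har⟩ := exists_meanProb_eq hm hxy hr
    rw [← hS] at ha har
    have hin : ∑ z ∈ S, meanProb φ d m x y z = S.card * a := by
      rw [Finset.sum_congr rfl ha, Finset.sum_const, nsmul_eq_mul]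
    have hout : ∑ z ∈ Sᶜ, meanProb φ d m x y z = 1 - S.card * a := by
      rw [← sum_meanProb (φ := φ) (d := d) (x := x) (y := y) m, ← Finset.sum_add_sum_compl S,
        hin]
      ring
    have h1 : ∑ z ∈ S, meanProb φ d m x y z * (betterNeighbours φ d x (improve φ d x y z)).card =
        a * ∑ z ∈ S, ((betterNeighbours φ d x z).card : ℝ) := by
      rw [Finset.mul_sum]
      refine Finset.sum_congr rfl fun z hz => ?_
      rw [ha z hz, improve, if_pos hz]
    have h2 : ∑ z ∈ Sᶜ, meanProb φ d m x y z *
        (betterNeighbours φ d x (improve φ d x y z)).card = (1 - S.card * a) * S.card := by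
      rw [← hout, Finset.sum_mul]
      refine Finset.sum_congr rfl fun z hz => ?_
      rw [improve, if_neg (Finset.mem_compl.mp hz)]
    have h3 : 2 * ∑ z ∈ S, ((betterNeighbours φ d x z).card : ℝ) ≤ (S.card : ℝ) ^ 2 := by
      exact_mod_cast two_mul_sum_card_betterNeighbours_le (φ := φ) (d := d) (x := x) (y := y)
    have hr' : (0 : ℝ) < S.card := by exact_mod_cast hr
    have ha0 : 0 < a := pos_of_mul_pos_left (lt_of_lt_of_le (by norm_num) har) hr'.le
    rw [← Finset.sum_add_sum_compl S, h1, h2]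
    have h4 := mul_le_mul_of_nonneg_left h3 ha0.le
    have h5 := mul_le_mul_of_nonneg_right har hr'.le
    linarith

/-- One round of the maximum search: Grover's algorithm with a random number of iterations, and a
query at the measurement result, which decides whether it replaces the current best string. -/
noncomputable def searchRound (d m : ℕ) (x y : BitString n) : QAlg n (BitString n) :=
  .toss m fun j => .circuit 0 (groverCircuit (searchAmp d x) y j) fun b =>
    .circuit 0 (compareCircuit y b.1) fun b' =>
      .ret (if b'.2.1 = true ∧ b.1 ∈ neighbours d x then b.1 else y)

theorem queriesLE_searchRound (f : BitString n → BitString n → Bool) (m : ℕ) :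
    (searchRound d m x y).QueriesLE f (m + 1) := by
  refine QAlg.QueriesLE.toss fun j => ?_
  have h : ∀ b : QBasis n 0, (QAlg.circuit 0 (compareCircuit y b.1) fun b' =>
      QAlg.ret (if b'.2.1 = true ∧ b.1 ∈ neighbours d x then b.1 else y)).QueriesLE f 1 := by
    intro b
    have h1 : circuitQueries (compareCircuit y b.1) = 1 := by
      simp [compareCircuit, circuitQueries, QGate.queries]
    exact (QAlg.QueriesLE.circuit fun b' => QAlg.QueriesLE.ret _).mono (by rw [h1])
  refine (QAlg.QueriesLE.circuit h).mono ?_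
  rw [circuitQueries_groverCircuit]
  omega

theorem expect_searchRound (m : ℕ) {g : BitString n → ℝ} (hg : ∀ z, 0 ≤ g z) :
    (searchRound d m x y).expect (markFun φ) (fun z => ENNReal.ofReal (g z)) =
      ENNReal.ofReal (∑ z, meanProb φ d m x y z * g (improve φ d x y z)) := by
  have hcompare : ∀ z : BitString n,
      (QAlg.circuit 0 (compareCircuit y z) fun b' =>
        QAlg.ret (if b'.2.1 = true ∧ z ∈ neighbours d x then z else y)).expect (markFun φ)
        (fun z => ENNReal.ofReal (g z)) = ENNReal.ofReal (g (improve φ d x y z)) := by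
    intro z
    rw [QAlg.expect_circuit, circuitState_compareCircuit,
      Finset.sum_eq_single (z, markFun φ y z, 0)]
    · simp only [Pi.single_eq_same, norm_one, one_pow, ENNReal.ofReal_one, one_mul,
        QAlg.expect_ret, improve, mem_betterNeighbours, markFun, decide_eq_true_eq, and_comm]
    · intro b _ hb
      simp [Pi.single_eq_of_ne hb]
    · simp
  rw [searchRound, QAlg.expect_toss]
  have hcircuit : ∀ j : Fin (m + 1), (QAlg.circuit 0 (groverCircuit (searchAmp d x) y j) fun b =>
      QAlg.circuit 0 (compareCircuit y b.1) fun b' =>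
        QAlg.ret (if b'.2.1 = true ∧ b.1 ∈ neighbours d x then b.1 else y)).expect (markFun φ)
        (fun z => ENNReal.ofReal (g z)) =
      ∑ b, ENNReal.ofReal
        (‖circuitState (markFun φ) (groverCircuit (searchAmp d x) y j) b‖ ^ 2) *
          ENNReal.ofReal (g (improve φ d x y b.1)) := by
    intro j
    rw [QAlg.expect_circuit]
    exact Finset.sum_congr rfl fun b _ => congrArg _ (hcompare b.1)
  rw [Finset.sum_congr rfl fun j _ => congrArg _ (hcircuit j)]
  have hinv : ((m + 1 : ℕ) : ℝ≥0∞)⁻¹ = ENNReal.ofReal (((m + 1 : ℕ) : ℝ)⁻¹) := by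
    rw [ENNReal.ofReal_inv_of_pos (by positivity), ENNReal.ofReal_natCast]
  simp only [hinv, ← ENNReal.ofReal_mul (sq_nonneg _)]
  have hnn : ∀ (j : ℕ) (b : QBasis n 0),
      0 ≤ ‖circuitState (markFun φ) (groverCircuit (searchAmp d x) y j) b‖ ^ 2 *
        g (improve φ d x y b.1) := fun j b => mul_nonneg (sq_nonneg _) (hg _)
  have hj : ∀ j : Fin (m + 1), ENNReal.ofReal (((m + 1 : ℕ) : ℝ)⁻¹) *
      ∑ b, ENNReal.ofReal (‖circuitState (markFun φ) (groverCircuit (searchAmp d x) y j) b‖ ^ 2 *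
        g (improve φ d x y b.1)) =
      ENNReal.ofReal (((m + 1 : ℕ) : ℝ)⁻¹ * ∑ z, groverProb (markFun φ) (searchAmp d x) y j z *
        g (improve φ d x y z)) := by
    intro j
    rw [← ENNReal.ofReal_sum_of_nonneg fun b _ => hnn j b, ← ENNReal.ofReal_mul (by positivity),
      sum_qBasis]
    simp only [groverProb, add_mul]
  rw [Finset.sum_congr rfl fun j _ => hj j, ← ENNReal.ofReal_sum_of_nonneg]
  · congr 1
    simp only [meanProb, Finset.sum_mul, Finset.mul_sum]
    rw [Finset.sum_comm]
    simp only [mul_assoc]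
  · intro j _
    exact mul_nonneg (by positivity)
      (Finset.sum_nonneg fun z _ => mul_nonneg (groverProb_nonneg _ _ _ _ _) (hg _))

end Round

/-! ### The quantum maximum search -/

section Search

variable {n : ℕ} {φ : BitString n → ℝ} {d : ℕ} {x y : BitString n}

/-- `R` rounds of the maximum search at `x`, starting with the best string `y`. -/
noncomputable def searchRounds (d m : ℕ) (x : BitString n) :
    ℕ → BitString n → QAlg n (BitString n)
  | 0, y => .ret y
  | R + 1, y => (searchRound d m x y).bind (searchRounds d m x R)

/-- The strings which can occur as the current best string. -/
def IsCandidate (φ : BitString n → ℝ) (d : ℕ) (x y : BitString n) : Prop :=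
  y = x ∨ y ∈ neighbours d x ∧ φ x < φ y

theorem IsCandidate.le (h : IsCandidate φ d x y) : φ x ≤ φ y := by
  rcases h with rfl | h
  · exact le_rfl
  · exact h.2.le

theorem IsCandidate.improve (h : IsCandidate φ d x y) (z : BitString n) :
    IsCandidate φ d x (improve φ d x y z) := by
  unfold _root_.improve
  split_ifs with hz
  · rw [mem_betterNeighbours] at hz
    exact Or.inr ⟨hz.1, h.le.trans_lt hz.2⟩
  · exact h

/-- The decision taken when the search at `x` has ended with the best string `y`. -/
def decision (x y : BitString n) : Option (BitString n) := if y = x then none else some y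

theorem IsCandidate.isSteepMove (h : IsCandidate φ d x y)
    (h0 : (betterNeighbours φ d x y).card = 0) : IsSteepMove φ d x (decision x y) := by
  have hmax : ∀ z ∈ neighbourhood d x, φ z ≤ φ y := by
    intro z hz
    by_contra! hlt
    have : z ∈ betterNeighbours φ d x y := mem_betterNeighbours.mpr ⟨mem_neighbours.mpr hz, hlt⟩
    rw [Finset.card_eq_zero.mp h0] at this
    exact Finset.notMem_empty _ this
  unfold decision
  split_ifs with hyx
  · subst hyx
    exact hmax
  · obtain ⟨hy, hlt⟩ := h.resolve_left hyx
    exact ⟨mem_neighbours.mp hy, hlt, hmax⟩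

open Classical in
/-- By Markov's inequality the failure probability is at most the expected number of better
neighbours at the end. -/
theorem expect_searchRounds_le {m : ℕ} (hm : (neighbours d x).card ≤ (m + 1) ^ 2) (R : ℕ)
    (hy : IsCandidate φ d x y) :
    (searchRounds d m x R y).expect (markFun φ)
      (fun z => if IsSteepMove φ d x (decision x z) then 0 else 1) ≤
      ENNReal.ofReal ((7 / 8) ^ R * (betterNeighbours φ d x y).card) := by
  -- The trivial bound `1` for non-candidates makes the induction hypothesis a bound at every
  -- string, as monotonicity of the expectation requires.
  have main : ∀ R y, (searchRounds d m x R y).expect (markFun φ)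
      (fun z => if IsSteepMove φ d x (decision x z) then 0 else 1) ≤
      ENNReal.ofReal (if IsCandidate φ d x y then (7 / 8) ^ R * (betterNeighbours φ d x y).card
        else 1) := by
    intro R
    induction R with
    | zero =>
      intro y
      simp only [searchRounds, QAlg.expect_ret, pow_zero, one_mul]
      split_ifs with h1 h2 h2
      · exact zero_le
      · exact zero_le
      · rw [ENNReal.ofReal_natCast]
        exact_mod_cast Nat.one_le_iff_ne_zero.mpr fun h0 => h1 (h2.isSteepMove h0)
      · simp
    | succ R ih =>
      intro y
      by_cases hy : IsCandidate φ d x y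
      · rw [searchRounds, QAlg.expect_bind]
        refine (QAlg.expect_mono _ _ ih).trans ?_
        rw [expect_searchRound]
        · refine ENNReal.ofReal_le_ofReal ?_
          simp only [hy, hy.improve, if_true]
          have := mul_le_mul_of_nonneg_left (sum_meanProb_mul_card_le (φ := φ) hm hy.le)
            (show (0 : ℝ) ≤ (7 / 8) ^ R by positivity)
          calc _ = (7 / 8 : ℝ) ^ R * ∑ z, meanProb φ d m x y z *
                (betterNeighbours φ d x (improve φ d x y z)).card := by
                rw [Finset.mul_sum]
                exact Finset.sum_congr rfl fun z _ => by ring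
            _ ≤ _ := this
            _ = _ := by ring
        · intro z
          split_ifs <;> positivity
      · simp only [hy, if_false, ENNReal.ofReal_one]
        refine (QAlg.expect_mono _ _ (h := fun _ => 1) fun z => ?_).trans
          (QAlg.expect_const _ _ 1).le
        split_ifs <;> simp
  simpa [hy] using main R y

theorem queriesLE_searchRounds (f : BitString n → BitString n → Bool) (m R : ℕ) :
    (searchRounds d m x R y).QueriesLE f (R * (m + 1)) := by
  induction R generalizing y with
  | zero => simpa [searchRounds] using QAlg.QueriesLE.ret y
  | succ R ih =>
    rw [Nat.succ_mul]
    exact (queriesLE_searchRound f m).bind fun z => ih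

/-- The number of rounds in iteration `t`, for at most `N` neighbours. Six rounds halve the
expected number of better neighbours, as `(7 / 8) ^ 6 ≤ 1 / 2`. -/
def numRounds (N t : ℕ) : ℕ := 6 * Nat.clog 2 (3 * N * (t + 1) * (t + 2))

theorem pow_numRounds_mul_le (N t : ℕ) :
    (7 / 8 : ℝ) ^ numRounds N t * N ≤ 1 / (3 * (t + 1) * (t + 2)) := by
  have h1 : ((3 * N * (t + 1) * (t + 2) : ℕ) : ℝ) ≤
      2 ^ Nat.clog 2 (3 * N * (t + 1) * (t + 2)) := by
    exact_mod_cast Nat.le_pow_clog one_lt_two _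
  set c := Nat.clog 2 (3 * N * (t + 1) * (t + 2)) with hc
  have h2 : (7 / 8 : ℝ) ^ numRounds N t ≤ (1 / 2) ^ c := by
    rw [numRounds, pow_mul]
    exact pow_le_pow_left₀ (by positivity) (by norm_num) _
  rw [le_div_iff₀ (by positivity)]
  calc (7 / 8 : ℝ) ^ numRounds N t * N * (3 * (t + 1) * (t + 2))
      = (7 / 8 : ℝ) ^ numRounds N t * ((3 * N * (t + 1) * (t + 2) : ℕ) : ℝ) := by
        push_cast
        ring
    _ ≤ (1 / 2) ^ c * 2 ^ c := mul_le_mul h2 h1 (by positivity) (by positivity)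
    _ = 1 := by rw [← mul_pow]; norm_num

/-- The quantum subroutine for the steepest ascent at `x` in iteration `t`. -/
noncomputable def quantumMax (n d t : ℕ) (x : BitString n) : QAlg n (Option (BitString n)) :=
  (searchRounds d (Nat.sqrt (maxNeighbours n d)) x (numRounds (maxNeighbours n d) t) x).bind
    fun y => .ret (decision x y)

open Classical in
theorem expect_quantumMax_fail_le (φ : BitString n → ℝ) (d t : ℕ) (x : BitString n) :
    (quantumMax n d t x).expect (markFun φ) (fun o => if IsSteepMove φ d x o then 0 else 1) ≤
      ENNReal.ofReal (1 / (3 * (t + 1) * (t + 2))) := by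
  simp only [quantumMax, QAlg.expect_bind, QAlg.expect_ret]
  have hm : (neighbours d x).card ≤ (Nat.sqrt (maxNeighbours n d) + 1) ^ 2 :=
    (card_neighbours_le d x).trans (Nat.lt_succ_sqrt' _).le
  refine (expect_searchRounds_le hm _ (Or.inl rfl)).trans (ENNReal.ofReal_le_ofReal ?_)
  refine le_trans ?_ (pow_numRounds_mul_le (maxNeighbours n d) t)
  have h : (betterNeighbours φ d x x).card ≤ maxNeighbours n d :=
    (Finset.card_le_card (Finset.filter_subset _ _)).trans (card_neighbours_le d x)
  have h' : ((betterNeighbours φ d x x).card : ℝ) ≤ maxNeighbours n d := by exact_mod_cast h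
  exact mul_le_mul_of_nonneg_left h' (by positivity)

/-- The number of queries which suffice for the steepest ascent in iteration `t`. -/
def maxQueries (n d t : ℕ) : ℕ :=
  numRounds (maxNeighbours n d) t * (Nat.sqrt (maxNeighbours n d) + 1)

theorem queriesLE_quantumMax (f : BitString n → BitString n → Bool) (t : ℕ) :
    (quantumMax n d t x).QueriesLE f (maxQueries n d t) := by
  rw [maxQueries, ← Nat.zero_add (_ * _)]
  exact (queriesLE_searchRounds f _ _).bind fun y => QAlg.QueriesLE.ret _

end Search

/-! ### The number of queries -/

theorem numRounds_le {n d t : ℕ} (hn : 1 ≤ n) (ht : 1 ≤ t) :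
    (numRounds ((n + 1) ^ d) t : ℝ) ≤
      6 * ((d + 3) / Real.log 2 + 1) * Real.log ((n : ℝ) * t + 2) := by
  have hnt : n ≤ n * t ∧ t ≤ n * t := ⟨Nat.le_mul_of_pos_right n ht, Nat.le_mul_of_pos_left t hn⟩
  have hK : 3 * (n + 1) ^ d * (t + 1) * (t + 2) ≤ (n * t + 2) ^ (d + 3) := by
    calc 3 * (n + 1) ^ d * (t + 1) * (t + 2)
        ≤ (n * t + 2) * (n * t + 2) ^ d * (n * t + 2) * (n * t + 2) := by
          gcongr <;> omega
      _ = _ := by ring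
  have hL : (3 : ℝ) ≤ n * t + 2 := by
    have : (1 : ℝ) ≤ n * t := by exact_mod_cast Nat.mul_pos hn ht
    linarith
  have hlogL : 1 ≤ Real.log ((n : ℝ) * t + 2) := by
    rw [Real.le_log_iff_exp_le (by linarith)]
    linarith [Real.exp_one_lt_d9]
  have hlog2 : 0 < Real.log 2 := Real.log_pos one_lt_two
  have hclog : (Nat.clog 2 ((n * t + 2) ^ (d + 3)) : ℝ) ≤
      (d + 3) * Real.log ((n : ℝ) * t + 2) / Real.log 2 + 1 := by
    rw [← Real.natCeil_logb_natCast]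
    refine (Nat.ceil_lt_add_one ?_).le.trans (le_of_eq ?_)
    · refine Real.logb_nonneg (by norm_num) ?_
      exact_mod_cast Nat.one_le_pow _ _ (by omega)
    · rw [Real.logb]
      push_cast
      rw [Real.log_pow]
      push_cast
      rfl
  have h1 : (Nat.clog 2 (3 * (n + 1) ^ d * (t + 1) * (t + 2)) : ℝ) ≤
      Nat.clog 2 ((n * t + 2) ^ (d + 3)) := by
    exact_mod_cast Nat.clog_mono_right 2 hK
  rw [numRounds]
  push_cast
  calc 6 * (Nat.clog 2 (3 * (n + 1) ^ d * (t + 1) * (t + 2)) : ℝ)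
      ≤ 6 * ((d + 3) * Real.log ((n : ℝ) * t + 2) / Real.log 2 +
          Real.log ((n : ℝ) * t + 2)) := by linarith
    _ = _ := by ring

theorem sqrt_add_one_le {n : ℕ} (d : ℕ) (hn : 1 ≤ n) :
    (Nat.sqrt ((n + 1) ^ d) + 1 : ℝ) ≤ 2 * 2 ^ ((d : ℝ) / 2) * (n : ℝ) ^ ((d : ℝ) / 2) := by
  have hn' : (1 : ℝ) ≤ n := by exact_mod_cast hn
  have h1 : (Nat.sqrt ((n + 1) ^ d) : ℝ) ≤ (2 * n : ℝ) ^ ((d : ℝ) / 2) := by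
    refine Real.nat_sqrt_le_real_sqrt.trans ?_
    rw [Real.sqrt_eq_rpow]
    push_cast
    rw [← Real.rpow_natCast, ← Real.rpow_mul (by positivity), mul_one_div]
    exact Real.rpow_le_rpow (by positivity) (by linarith) (by positivity)
  have h2 : (1 : ℝ) ≤ (2 * n : ℝ) ^ ((d : ℝ) / 2) :=
    Real.one_le_rpow (by linarith) (by positivity)
  rw [mul_assoc, ← Real.mul_rpow (by norm_num) (by positivity)]
  linarith

theorem maxQueries_le (n d : ℕ) {t : ℕ} (ht : 1 ≤ t) :
    (maxQueries n d t : ℝ) ≤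
      12 * 2 ^ ((d : ℝ) / 2) * ((d + 3) / Real.log 2 + 1) * (n : ℝ) ^ ((d : ℝ) / 2) *
        Real.log ((n : ℝ) * t + 2) := by
  have hlog2 : 0 < Real.log 2 := Real.log_pos one_lt_two
  have hlog : 0 ≤ Real.log ((n : ℝ) * t + 2) :=
    Real.log_nonneg (by linarith [show (0 : ℝ) ≤ n * t by positivity])
  rcases Nat.eq_zero_or_pos n with rfl | hn
  · have h0 : maxQueries 0 d t = 0 := by simp [maxQueries, numRounds, maxNeighbours]
    rw [h0]
    exact Nat.cast_zero.trans_le (mul_nonneg (by positivity) hlog)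
  · rw [maxQueries, maxNeighbours, if_neg hn.ne']
    push_cast
    calc _ ≤ 6 * ((d + 3) / Real.log 2 + 1) * Real.log ((n : ℝ) * t + 2) *
          (2 * 2 ^ ((d : ℝ) / 2) * (n : ℝ) ^ ((d : ℝ) / 2)) :=
          mul_le_mul (numRounds_le hn ht) (sqrt_add_one_le d hn) (by positivity) (by positivity)
      _ = _ := by ring

/-! ### The steep quantum hill climber -/

theorem mainTheorem12 (d : ℕ) :
    ∃ (C : ℝ) (a : ℕ), 0 < C ∧
      ∀ n : ℕ, ∃ qmax : ℕ → BitString n → QAlg n (Option (BitString n)),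
        ∀ (k : ℕ) (I : MaxSatInstance n k),
          -- each local search is a bounded-error quantum search for the best move
          (∀ (t : ℕ) (x : BitString n),
            2 / 3 ≤ ((qmax t x).run (markFun I.objective)).toOuterMeasure
              {z | IsSteepMove I.objective d x z.1}) ∧
          ∀ (T : ℕ) (x₀ : BitString n),
            -- the whole run is one of a classical steep hill climber
            2 / 3 ≤ ((quantumClimb qmax 1 T x₀).run (markFun I.objective)).toOuterMeasure
              {z | ∃ s, IsSteepRule I.objective d s ∧ z.1 = classicalClimb s T x₀} ∧
            -- expected number of calls to the objective function, if each query to one of the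
            -- oracles is implemented with `cq` calls
            ∀ cq : ℕ,
              ∑' z, (quantumClimb qmax 1 T x₀).run (markFun I.objective) z *
                  ((cq * z.2 : ℕ) : ℝ≥0∞) ≤
                ∑' z, (quantumClimb qmax 1 T x₀).run (markFun I.objective) z *
                  ENNReal.ofReal (∑ t ∈ Finset.Icc 1 (iterations T z.1),
                    C * cq * (n : ℝ) ^ ((d : ℝ) / 2) * Real.log ((n : ℝ) * t + 2) ^ a) := by
  refine ⟨12 * 2 ^ ((d : ℝ) / 2) * ((d + 3) / Real.log 2 + 1), 1, ?_, fun n =>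
    ⟨quantumMax n d, fun k I => ⟨fun t x => ?_, fun T x₀ => ⟨?_, fun cq => ?_⟩⟩⟩⟩
  · have : 0 < Real.log 2 := Real.log_pos one_lt_two
    positivity
  · classical
    refine QAlg.two_thirds_le_of_expect_le _ _ (IsSteepMove I.objective d x) ?_
    refine (expect_quantumMax_fail_le I.objective d t x).trans ?_
    refine (ENNReal.ofReal_le_ofReal (q := 3⁻¹) ?_).trans (by
      rw [ENNReal.ofReal_inv_of_pos (by norm_num), ENNReal.ofReal_ofNat])
    rw [← one_div, mul_assoc]
    refine one_div_le_one_div_of_le (by norm_num) ?_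
    nlinarith [show (0 : ℝ) ≤ t from Nat.cast_nonneg t]
  · classical
    refine QAlg.two_thirds_le_of_expect_le _ _ (IsSteepClimb I.objective d T x₀) ?_
    refine (expect_quantumClimb_fail_le (expect_quantumMax_fail_le I.objective d) 1 T x₀).trans ?_
    refine (ENNReal.ofReal_le_ofReal (q := 3⁻¹) (by norm_num)).trans (by
      rw [ENNReal.ofReal_inv_of_pos (by norm_num), ENNReal.ofReal_ofNat])
  · -- The bound holds for every run, not only on average.
    refine ENNReal.tsum_le_tsum fun z => ?_
    by_cases hz : z ∈ ((quantumClimb (quantumMax n d) 1 T x₀).run (markFun I.objective)).support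
    · refine mul_le_mul_right ?_ _
      have hq := queries_quantumClimb_le (fun t x => queriesLE_quantumMax (x := x) (d := d)
        (markFun I.objective) t) 1 T x₀ z hz
      rw [← ENNReal.ofReal_natCast]
      refine ENNReal.ofReal_le_ofReal ?_
      rw [← Finset.Ico_add_one_right_eq_Icc, Finset.sum_Ico_eq_sum_range, Nat.add_sub_cancel]
      push_cast
      have hq' : (z.2 : ℝ) ≤
          ∑ i ∈ Finset.range (iterations T z.1), (maxQueries n d (1 + i) : ℝ) := by
        exact_mod_cast hq
      refine (mul_le_mul_of_nonneg_left hq' (Nat.cast_nonneg cq)).trans ?_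
      rw [Finset.mul_sum]
      refine Finset.sum_le_sum fun i _ => ?_
      have hi := mul_le_mul_of_nonneg_left (maxQueries_le n d (Nat.le_add_right 1 i))
        (Nat.cast_nonneg (α := ℝ) cq)
      push_cast at hi
      rw [pow_one]
      linarith
    · rw [PMF.mem_support_iff, not_not] at hz
      simp [hz]
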